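/- Let $n\ge 1$ and let $f:\{0,1\}^n\to\{0,1\}$ be a total Boolean function. Below, $x$ ranges over $f^{-1}(0)$, $y$ over $f^{-1}(1)$, $z,z'$ over $\{0,1\}^n$ and $i$ over $[n]=\{1,\dots,n\}$. All quantities take values in $[0,\infty]$, with $1/0=\infty$ and with the maximum of an empty set equal to $0$. Let $p$ range over families of probability distributions $p_z=(p_{z,i})_{i\in[n]}$, $z\in\{0,1\}^n$. Define: - the private coin certificate game complexity $\mathsf{CG}(f)=\min_p\max_{x,y}\Big(\sum_{i:x_i\ne y_i}p_{x,i}\,p_{y,i}\Big)^{-1}$; - the minimax form of the positive adversary bound $\mathsf{MM}(f)=\min_p\max_{x,y}\Big(\sum_{i:x_i\ne y_i}\sqrt{p_{x,i}\,p_{y,i}}\Big)^{-1}$; - the public coin certificate game complexity $\mathsf{CG}^{\mathrm{pub}}(f)=\min_q\max_{x,y}\Big(\Pr_{(A,B)\sim q}\big[A(x)=B(y)=i\text{ for some } i \text{ with } x_i\ne y_i\big]\Big)^{-1}$, where $q$ ranges over the probability distributions on pairs of functions $A:f^{-1}(0)\to[n]$, $B:f^{-1}(1)\to[n]$; - the expectational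 certificate complexity $\mathsf{EC}(f)=\min_w\max_z\sum_i w_{z,i}$, where $w$ ranges over the families $0\le w_{z,i}\le 1$ such that $\sum_{i:z_i\ne z'_i}w_{z,i}\,w_{z',i}\ge 1$ whenever $f(z)\neq f(z')$; - the zero-error randomized query complexity $\mathsf{R}_0(f)$: the minimum, over probability distributions on deterministic decision trees that compute $f$ correctly on all inputs, of the maximum over $z$ of the expected number of queries made on $z$; - the sensitivity $\mathsf{s}(f)$: the maximum over $z$ of the number of indices $i$ such that flipping the $i$-th bit of $z$ changes the value of $f$; - for $b\in\{0,1\}$, the $b$-certificate complexity $\mathsf{C}^b(f)$: the maximum over $z\in f^{-1}(b)$ of the least size of a partial assignment that is consistent with $z$ and forces $f$ to be constant on all inputs consistent with it. Then there are universal constants $K_1,K_2$, independent of $n$ and $f$, such that for every such $n$ and $f$: 1. $\mathsf{MM}(f)^2\le\mathsf{CG}(f)$; 2. $\mathsf{R}_0(f)\le\mathsf{CG}(f)$ and $\mathsf{CG}(f)\le K_1\,\mathsf{EC}(f)^2$; 3. $\mathsf{CG}(f)\le K_2\,\mathsf{CG}^{\mathrm{pub}}(f)^2\,\mathsf{s}(f)$;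 4. $\mathsf{CG}(f)\le\mathsf{C}^0(f)\,\mathsf{C}^1(f)$. -/

import Mathlib

open scoped NNReal ENNReal

namespace CertGame

/-- Inputs of length `n`. -/
abbrev Input (n : ℕ) : Type := Fin n → Bool

/-- Total Boolean functions on `n` variables. -/
abbrev BoolFun (n : ℕ) : Type := Input n → Bool

/-! ### Certificate games

All the game values live in `ℝ≥0∞`, so that the reciprocal of a zero winning probability is `∞`
and the maximum over an empty set of input pairs is `0`. -/

/-- Families `p` of probability distributions `p x` on the index set, one for each input `x`. -/
abbrev PrivateStrategy (n : ℕ) : Type :=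
  {p : Input n → Fin n → ℝ≥0 // ∀ x, ∑ i, p x i = 1}

/-- The probability that the two players, sampling independently from `p x` and `p y`, output a
common index at which `x` and `y` differ. -/
noncomputable def privateWin {n : ℕ} (p : PrivateStrategy n) (x y : Input n) : ℝ≥0 :=
  ∑ i with x i ≠ y i, p.1 x i * p.1 y i

/-- Private coin certificate game complexity. -/
noncomputable def CG {n : ℕ} (f : BoolFun n) : ℝ≥0∞ :=
  ⨅ p : PrivateStrategy n, ⨆ (x : {x : Input n // f x = false}) (y : {y : Input n // f y = true}),
    (privateWin p x.1 y.1 : ℝ≥0∞)⁻¹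

/-- Pairs `(A, B)` of deterministic strategies, `A` for the player who holds a `0`-input and `B`
for the player who holds a `1`-input. -/
abbrev DetStrategy {n : ℕ} (f : BoolFun n) : Type :=
  ({x : Input n // f x = false} → Fin n) × ({y : Input n // f y = true} → Fin n)

/-- The pair of strategies `S` is correct on `x, y`. -/
def DetStrategy.Correct {n : ℕ} {f : BoolFun n} (S : DetStrategy f)
    (x : {x : Input n // f x = false}) (y : {y : Input n // f y = true}) : Prop :=
  S.1 x = S.2 y ∧ x.1 (S.1 x) ≠ y.1 (S.1 x)

/-- Public coin strategies: probability distributions on pairs of deterministic strategies. -/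
abbrev PublicStrategy {n : ℕ} (f : BoolFun n) : Type :=
  {p : DetStrategy f → ℝ≥0 // ∑ S, p S = 1}

open Classical in
/-- The winning probability of a public coin strategy on `x, y`. -/
noncomputable def publicWin {n : ℕ} {f : BoolFun n} (p : PublicStrategy f)
    (x : {x : Input n // f x = false}) (y : {y : Input n // f y = true}) : ℝ≥0 :=
  ∑ S : DetStrategy f with S.Correct x y, p.1 S

/-- Public coin certificate game complexity. -/
noncomputable def CGpub {n : ℕ} (f : BoolFun n) : ℝ≥0∞ :=
  ⨅ p : PublicStrategy f, ⨆ (x : {x : Input n // f x = false}) (y : {y : Input n // f y = true}),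
    (publicWin p x y : ℝ≥0∞)⁻¹

/-! ### The positive adversary bound and expectational certificate complexity -/

/-- The positive adversary method, minimax formulation. -/
noncomputable def MM {n : ℕ} (f : BoolFun n) : ℝ≥0∞ :=
  ⨅ p : PrivateStrategy n, ⨆ (x : {x : Input n // f x = false}) (y : {y : Input n // f y = true}),
    ((∑ i with x.1 i ≠ y.1 i, NNReal.sqrt (p.1 x.1 i * p.1 y.1 i) : ℝ≥0) : ℝ≥0∞)⁻¹

/-- The weight schemes that are feasible for expectational certificate complexity. -/
def ECFeasible {n : ℕ} (f : BoolFun n) (w : Input n → Fin n → ℝ≥0) : Prop :=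
  (∀ z i, w z i ≤ 1) ∧
    ∀ z z' : Input n, f z ≠ f z' → 1 ≤ ∑ i with z i ≠ z' i, w z i * w z' i

/-- Expectational certificate complexity. -/
noncomputable def EC {n : ℕ} (f : BoolFun n) : ℝ≥0∞ :=
  ⨅ w : {w : Input n → Fin n → ℝ≥0 // ECFeasible f w},
    ⨆ z : Input n, ((∑ i, w.1 z i : ℝ≥0) : ℝ≥0∞)

/-! ### Zero-error randomized query complexity -/

/-- Deterministic decision trees on `n` variables. -/
inductive DecisionTree (n : ℕ) : Type
  | leaf (b : Bool) : DecisionTree n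
  | query (i : Fin n) (t₀ t₁ : DecisionTree n) : DecisionTree n

/-- The output of a decision tree: `query i t₀ t₁` continues with `t₀` if the `i`-th bit is `0`
and with `t₁` if it is `1`. -/
def DecisionTree.eval {n : ℕ} : DecisionTree n → Input n → Bool
  | .leaf b, _ => b
  | .query i t₀ t₁, x => bif x i then t₁.eval x else t₀.eval x

/-- The number of queries that a decision tree makes on an input. -/
def DecisionTree.cost {n : ℕ} : DecisionTree n → Input n → ℕ
  | .leaf _, _ => 0
  | .query i t₀ t₁, x => 1 + (bif x i then t₁.cost x else t₀.cost x)

/-- A randomized decision tree `μ` computes `f` with zero error. -/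
def ZeroError {n : ℕ} (f : BoolFun n) (μ : PMF (DecisionTree n)) : Prop :=
  ∀ T ∈ μ.support, ∀ x, T.eval x = f x

/-- Zero-error randomized query complexity: the least worst-case expected number of queries of a
randomized decision tree that computes `f` with zero error. -/
noncomputable def R0 {n : ℕ} (f : BoolFun n) : ℝ≥0∞ :=
  ⨅ μ : {μ : PMF (DecisionTree n) // ZeroError f μ},
    ⨆ x : Input n, ∑' T : DecisionTree n, μ.1 T * (T.cost x : ℝ≥0∞)

/-! ### Sensitivity and certificate complexity -/

/-- The input `x` with its `i`-th bit flipped. -/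
def flipBit {n : ℕ} (x : Input n) (i : Fin n) : Input n := Function.update x i (!x i)

/-- The number of sensitive indices of `x`. -/
def sensitivityAt {n : ℕ} (f : BoolFun n) (x : Input n) : ℕ :=
  (Finset.univ.filter fun i => f (flipBit x i) ≠ f x).card

/-- Sensitivity. -/
def sensitivity {n : ℕ} (f : BoolFun n) : ℕ :=
  Finset.univ.sup fun x : Input n => sensitivityAt f x

/-- Partial assignments; `none` means that the bit is not assigned. -/
abbrev PartialAssignment (n : ℕ) : Type := Fin n → Option Bool

/-- The number of assigned bits. -/
def PartialAssignment.size {n : ℕ} (α : PartialAssignment n) : ℕ :=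
  (Finset.univ.filter fun i => α i ≠ none).card

/-- The partial assignment `α` is consistent with the input `x`. -/
def PartialAssignment.Consistent {n : ℕ} (α : PartialAssignment n) (x : Input n) : Prop :=
  ∀ i b, α i = some b → x i = b

/-- `α` is a certificate for `f` at the input `x`: it is consistent with `x`, and `f` is constant
on the inputs that are consistent with `α`. -/
def IsCertificateFor {n : ℕ} (f : BoolFun n) (x : Input n) (α : PartialAssignment n) : Prop :=
  α.Consistent x ∧ ∃ b, ∀ z, α.Consistent z → f z = b

/-- The size of a smallest certificate for `x` (the whole input is always a certificate). -/
noncomputable def certAt {n : ℕ} (f : BoolFun n) (x : Input n) : ℕ :=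
  sInf {k | ∃ α : PartialAssignment n, IsCertificateFor f x α ∧ α.size = k}

/-- The `b`-certificate complexity, `0` if `f` does not take the value `b`. -/
noncomputable def certComplexity {n : ℕ} (b : Bool) (f : BoolFun n) : ℕ :=
  (Finset.univ.filter fun x : Input n => f x = b).sup fun x => certAt f x

end CertGame

namespace CertGame

/-! Three bounds come from explicit strategies. `MM` is compared through `∑ aᵢ² ≤ (∑ aᵢ)²` with `aᵢ
= √(p_{x,i} p_{y,i})`. For `EC`, the weights are divided by the largest total weight (so `K₁ = 1`).
For `C⁰C¹`, each player samples uniformly from a smallest certificate, because certificates of a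
0-input and a 1-input share a position where the inputs differ.

For the public coin bound, the answer distributions of each player form a fractional certificate: `p
x` has mass at least `c = 1 / CGpub` on the differences of `x` from any input of opposite value.
`exists_sensitive_hybrid` shows that discarding weights below `c / (2s)` costs at most `c / 2`, and
`le_sum_min` makes the surviving weights overlap. A product of two surviving weights is at least `c
/ (2s)` times their minimum, which gives `c² / (4s)` (so `K₂ = 4`).

For `R0`, fix the queried bits and restrict the vectors `p z` to the unqueried positions. Inner
products between the two classes remain at least `c`, so a minimum-norm point of one convex hull has
inner product at least `c` with every vector of both (`exists_inner_ge_of_inner_ge`). Querying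
according to this point consumes, in expectation, at least `c` of the mass of `p z`; that mass is at
most 1, so at most `1 / c` queries are expected. -/

theorem CG_eq_zero_of_const {n : ℕ} (hn : 0 < n) (f : BoolFun n)
    (h : ∀ x y, f x = false → f y = true → False) : CG f = 0 := by
  have p : PrivateStrategy n := ⟨fun _ => Pi.single ⟨0, hn⟩ 1, fun _ => by simp⟩
  refine le_antisymm ((iInf_le _ p).trans ?_) bot_le
  exact iSup_le fun x => iSup_le fun y => (h x.1 y.1 x.2 y.2).elim

/-- Subprobability weights are as good as probability weights. -/
theorem CG_le_of_subprob {n : ℕ} (hn : 0 < n) (f : BoolFun n) (q : Input n → Fin n → ℝ≥0)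
    (hq : ∀ x, ∑ i, q x i ≤ 1) (c : ℝ≥0)
    (h : ∀ x y, f x = false → f y = true → c ≤ ∑ i with x i ≠ y i, q x i * q y i) :
    CG f ≤ (c : ℝ≥0∞)⁻¹ := by
  -- The missing mass goes to the first index, which can only increase winning probabilities.
  let p : PrivateStrategy n :=
    ⟨fun x i => q x i + (Pi.single ⟨0, hn⟩ (1 - ∑ i, q x i) : Fin n → ℝ≥0) i, fun x => by
      rw [Finset.sum_add_distrib]
      simp only [Finset.sum_pi_single', Finset.mem_univ, if_true]
      exact add_tsub_cancel_of_le (hq x)⟩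
  refine (iInf_le _ p).trans (iSup_le fun x => iSup_le fun y => ?_)
  rw [ENNReal.inv_le_inv, ENNReal.coe_le_coe]
  refine (h x.1 y.1 x.2 y.2).trans (Finset.sum_le_sum fun i _ => ?_)
  exact mul_le_mul' le_self_add le_self_add

/-! ### Adversary bound, expectational certificates and certificate complexity. -/

theorem MM_sq_le_CG {n : ℕ} (f : BoolFun n) : MM f ^ 2 ≤ CG f := by
  refine le_iInf fun p => ?_
  have key : ∀ x y : Input n, privateWin p x y ≤
      (∑ i with x i ≠ y i, NNReal.sqrt (p.1 x i * p.1 y i)) ^ 2 := fun x y => by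
    refine le_trans (le_of_eq ?_) (Finset.sum_sq_le_sq_sum_of_nonneg fun i _ => zero_le)
    exact Finset.sum_congr rfl fun i _ => (NNReal.sq_sqrt _).symm
  have hM : MM f ≤ (⨆ (x : {x : Input n // f x = false}) (y : {y : Input n // f y = true}),
      (privateWin p x.1 y.1 : ℝ≥0∞)⁻¹) ^ (1 / 2 : ℝ) := by
    refine (iInf_le _ p).trans (iSup_le fun x => iSup_le fun y => ?_)
    rw [one_div, ENNReal.le_rpow_inv_iff (by norm_num)]
    refine le_trans ?_ (le_iSup₂ (f := fun (x : {x : Input n // f x = false})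
      (y : {y : Input n // f y = true}) => (privateWin p x.1 y.1 : ℝ≥0∞)⁻¹) x y)
    rw [ENNReal.inv_rpow, ENNReal.inv_le_inv]
    exact_mod_cast key x.1 y.1
  calc MM f ^ 2 ≤ (_ ^ (1 / 2 : ℝ)) ^ 2 := pow_le_pow_left' hM 2
    _ = _ := by
      rw [← ENNReal.rpow_natCast, ← ENNReal.rpow_mul]; norm_num

theorem le_iInf_sq {ι : Sort*} {a : ℝ≥0∞} {g : ι → ℝ≥0∞} (h : ∀ i, a ≤ g i ^ 2) :
    a ≤ (⨅ i, g i) ^ 2 := by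
  have hle : a ^ (1 / 2 : ℝ) ≤ ⨅ i, g i := le_iInf fun i => by
    rw [one_div, ENNReal.rpow_inv_le_iff (by norm_num)]
    exact_mod_cast h i
  calc a = (a ^ (1 / 2 : ℝ)) ^ 2 := by
        rw [← ENNReal.rpow_natCast, ← ENNReal.rpow_mul]; norm_num
    _ ≤ _ := pow_le_pow_left' hle 2

theorem CG_le_EC_sq {n : ℕ} (hn : 0 < n) (f : BoolFun n) : CG f ≤ EC f ^ 2 := by
  by_cases hconst : ∀ x y, f x = false → f y = true → False
  · rw [CG_eq_zero_of_const hn f hconst]; exact bot_le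
  push Not at hconst
  obtain ⟨a, b, ha, hb, -⟩ := hconst
  have main : ∀ w : {w : Input n → Fin n → ℝ≥0 // ECFeasible f w},
      CG f ≤ (⨆ z : Input n, ((∑ i, w.1 z i : ℝ≥0) : ℝ≥0∞)) ^ 2 := by
    rintro ⟨w, hw1, hw⟩
    set W : ℝ≥0 := Finset.univ.sup fun z => ∑ i, w z i with hWdef
    have hW : ∀ z, ∑ i, w z i ≤ W := fun z =>
      Finset.le_sup (f := fun z => ∑ i, w z i) (Finset.mem_univ z)
    have hW0 : W ≠ 0 := fun h0 => by
      have hz : ∀ i, w a i = 0 := fun i => by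
        have h1 := (Finset.single_le_sum (f := w a) (fun i _ => zero_le)
          (Finset.mem_univ i)).trans (hW a)
        rw [h0] at h1
        exact le_antisymm h1 zero_le
      have h2 := hw a b (by simp [ha, hb])
      simp [hz] at h2
    have hsup : (⨆ z : Input n, ((∑ i, w z i : ℝ≥0) : ℝ≥0∞)) = W := by
      apply le_antisymm
      · exact iSup_le fun z => ENNReal.coe_le_coe.2 (hW z)
      · obtain ⟨z, -, hz⟩ := Finset.exists_mem_eq_sup (Finset.univ : Finset (Input n))
          ⟨a, Finset.mem_univ _⟩ fun z => ∑ i, w z i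
        rw [hWdef, hz]
        exact le_iSup (fun z : Input n => ((∑ i, w z i : ℝ≥0) : ℝ≥0∞)) z
    change _ ≤ (⨆ z : Input n, ((∑ i, w z i : ℝ≥0) : ℝ≥0∞)) ^ 2
    rw [hsup]
    have := CG_le_of_subprob hn f (fun z i => w z i / W) (fun z => by
      rw [← Finset.sum_div]
      exact div_le_one_of_le₀ (hW z) zero_le) ((W ^ 2)⁻¹) (fun x y hx hy => by
      have h1 := hw x y (by simp [hx, hy])
      calc (W ^ 2)⁻¹ = 1 * (W ^ 2)⁻¹ := (one_mul _).symm
        _ ≤ (∑ i with x i ≠ y i, w x i * w y i) * (W ^ 2)⁻¹ := by gcongr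
        _ = _ := by
          rw [Finset.sum_mul]
          refine Finset.sum_congr rfl fun i _ => ?_
          field_simp)
    rwa [ENNReal.coe_inv (pow_ne_zero 2 hW0), inv_inv, ENNReal.coe_pow] at this
  exact le_iInf_sq main

theorem exists_isCertificateFor_size_eq {n : ℕ} (f : BoolFun n) (x : Input n) :
    ∃ α : PartialAssignment n, IsCertificateFor f x α ∧ α.size = certAt f x :=
  Nat.sInf_mem (s := {k | ∃ α : PartialAssignment n, IsCertificateFor f x α ∧ α.size = k})
    ⟨_, fun i => some (x i), ⟨fun i b h => by simpa using h, f x, fun z hz => by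
      rw [show z = x from funext fun i => hz i _ rfl]⟩, rfl⟩

theorem IsCertificateFor.exists_ne {n : ℕ} {f : BoolFun n} {x y : Input n}
    {α β : PartialAssignment n} (hα : IsCertificateFor f x α) (hβ : IsCertificateFor f y β)
    (hxy : f x ≠ f y) : ∃ i, α i ≠ none ∧ β i ≠ none ∧ x i ≠ y i := by
  by_contra! hcon
  obtain ⟨hαx, b, hb⟩ := hα
  obtain ⟨hβy, d, hd⟩ := hβ
  -- If the inputs agreed wherever both certificates are defined, this mixture would be consistent
  -- with both.
  let z : Input n := fun i => if α i ≠ none then x i else y i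
  have h1 : f z = b := hb z fun i e he => by
    simp only [z, he, ne_eq, reduceCtorEq, not_false_eq_true, if_true]
    exact hαx i e he
  have h2 : f z = d := hd z fun i e he => by
    by_cases hi : α i = none
    · simpa [z, hi] using hβy i e he
    · have := hcon i hi (by simp [he])
      simpa [z, hi, this] using hβy i e he
  exact hxy ((hb x hαx).trans (h1.symm.trans (h2.trans (hd y hβy).symm)))

theorem CG_le_certComplexity_mul {n : ℕ} (hn : 0 < n) (f : BoolFun n) :
    CG f ≤ (certComplexity false f : ℝ≥0∞) * (certComplexity true f : ℝ≥0∞) := by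
  by_cases hconst : ∀ x y, f x = false → f y = true → False
  · rw [CG_eq_zero_of_const hn f hconst]; exact bot_le
  push Not at hconst
  obtain ⟨a, b, ha, hb, -⟩ := hconst
  choose α hα hsize using exists_isCertificateFor_size_eq f
  have hC : ∀ z, certAt f z ≤ certComplexity (f z) f := fun z =>
    Finset.le_sup (f := fun x => certAt f x) (by simp)
  have hpos : ∀ x y, f x ≠ f y → 0 < certAt f x := fun x y hxy => by
    obtain ⟨i, hi, -, -⟩ := (hα x).exists_ne (hα y) hxy
    rw [← hsize x]
    exact Finset.card_pos.2 ⟨i, by simp [hi]⟩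
  have h0 : certComplexity false f ≠ 0 := by
    have := (hpos a b (by simp [ha, hb])).trans_le (hC a)
    rw [ha] at this; exact this.ne'
  have h1 : certComplexity true f ≠ 0 := by
    have := (hpos b a (by simp [ha, hb])).trans_le (hC b)
    rw [hb] at this; exact this.ne'
  have := CG_le_of_subprob hn f (fun z i => if α z i ≠ none then ((certAt f z : ℝ≥0))⁻¹ else 0)
    (fun z => by
      rw [← Finset.sum_filter, Finset.sum_const, nsmul_eq_mul, ← div_eq_mul_inv]
      refine div_le_one_of_le₀ ?_ zero_le
      rw [← hsize z]
      rfl)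
    ((certComplexity false f : ℝ≥0) * (certComplexity true f : ℝ≥0))⁻¹ (fun x y hx hy => by
      have hxy : f x ≠ f y := by simp [hx, hy]
      obtain ⟨i, hi, hi', hne⟩ := (hα x).exists_ne (hα y) hxy
      refine le_trans ?_ (Finset.single_le_sum (fun i _ => zero_le)
        (Finset.mem_filter.2 ⟨Finset.mem_univ i, hne⟩))
      simp only [hi, hi', ne_eq, not_false_eq_true, if_true]
      have e0 := hC x
      have e1 := hC y
      rw [hx] at e0
      rw [hy] at e1
      have p0 := hpos x y hxy
      have p1 := hpos y x hxy.symm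
      rw [mul_inv]
      gcongr)
  rw [ENNReal.coe_inv (by simp [h0, h1]), inv_inv] at this
  exact_mod_cast this

end CertGame

namespace CertGame

/-! ### From fractional certificates to certificate games -/

/-- If `f x ≠ f y` then `y` can be pulled back towards `x` until every remaining difference is
sensitive. -/
theorem exists_sensitive_hybrid {n : ℕ} (f : BoolFun n) (x y : Input n) (hxy : f x ≠ f y) :
    ∃ z, f z ≠ f x ∧ (∀ i, x i ≠ z i → x i ≠ y i) ∧
      (Finset.univ.filter fun i => x i ≠ z i).card ≤ sensitivity f := by
  classical
  -- A closest such input to `x` is sensitive at each remaining difference: otherwise flipping that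
  -- bit would bring it closer.
  let P : Finset (Input n) := Finset.univ.filter fun z => f z ≠ f x ∧ ∀ i, x i ≠ z i → x i ≠ y i
  have hP : P.Nonempty := ⟨y, by simp [P, hxy.symm]⟩
  obtain ⟨z, hz, hmin⟩ :=
    P.exists_min_image (fun z => (Finset.univ.filter fun i => x i ≠ z i).card) hP
  simp only [P, Finset.mem_filter, Finset.mem_univ, true_and] at hz hmin
  refine ⟨z, hz.1, hz.2, ?_⟩
  refine le_trans ?_ (Finset.le_sup (f := fun x : Input n => sensitivityAt f x)
    (Finset.mem_univ z))
  refine Finset.card_le_card fun i hi => ?_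
  simp only [Finset.mem_filter, Finset.mem_univ, true_and] at hi ⊢
  have hflip : ∀ j, x j ≠ flipBit z i j ↔ x j ≠ z j ∧ j ≠ i := fun j => by
    by_cases hj : j = i
    · subst hj
      have : x j = !z j := by cases h1 : x j <;> cases h2 : z j <;> simp_all
      simp [flipBit, this]
    · simp [flipBit, hj]
  intro heq
  have hlt : (Finset.univ.filter fun j => x j ≠ flipBit z i j).card <
      (Finset.univ.filter fun j => x j ≠ z j).card := by
    refine Finset.card_lt_card (Finset.ssubset_iff_subset_ne.2 ⟨fun j => ?_, fun h => ?_⟩)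
    · simp only [Finset.mem_filter, Finset.mem_univ, true_and, hflip]
      exact fun h => h.1
    · have : i ∈ Finset.univ.filter fun j => x j ≠ z j := by simp [hi]
      rw [← h] at this
      simp [hflip] at this
  exact absurd (hmin _ ⟨heq ▸ hz.1, fun j hj => hz.2 j ((hflip j).1 hj).1⟩) (not_le.2 hlt)

/-- Two fractional certificates overlap on the differing positions. -/
theorem le_sum_min {n : ℕ} (f : BoolFun n) (q : Input n → Fin n → ℝ≥0) (c : ℝ≥0)
    (h : ∀ x y, f x ≠ f y → c ≤ ∑ i with x i ≠ y i, q x i) (x y : Input n) (hxy : f x ≠ f y) :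
    c ≤ ∑ i with x i ≠ y i, min (q x i) (q y i) := by
  classical
  -- Each bit is copied from the input of larger weight, so `z` differs from either input only where
  -- that input's weight is the minimum. Its value differs from that of one of them.
  let z : Input n := fun i => if q y i ≤ q x i then x i else y i
  by_cases hz : f z = f x
  · refine (h y z (by rw [hz]; exact hxy.symm)).trans ?_
    refine le_trans (le_of_eq ?_) (Finset.sum_le_sum_of_subset
      (s := Finset.univ.filter fun i => y i ≠ z i) fun i => ?_)
    · refine Finset.sum_congr rfl fun i hi => ?_
      by_cases hle : q y i ≤ q x i
      · exact (min_eq_right hle).symm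
      · simp [z, hle] at hi
    · simp only [Finset.mem_filter, Finset.mem_univ, true_and, z]
      split_ifs
      · exact fun h => h.symm
      · simp
  · refine (h x z (Ne.symm hz)).trans ?_
    refine le_trans (le_of_eq ?_) (Finset.sum_le_sum_of_subset
      (s := Finset.univ.filter fun i => x i ≠ z i) fun i => ?_)
    · refine Finset.sum_congr rfl fun i hi => ?_
      by_cases hle : q y i ≤ q x i
      · simp [z] at hi
        exact absurd hi.1 (not_lt.2 hle)
      · exact (min_eq_left (le_of_not_ge hle)).symm
    · simp only [Finset.mem_filter, Finset.mem_univ, true_and, z]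
      split_ifs
      · simp
      · exact id

/-- Truncation turns one-sided mass into a lower bound on products; sensitivity controls the mass
lost. -/
theorem CG_le_of_fractional {n : ℕ} (hn : 0 < n) (f : BoolFun n) (p : Input n → Fin n → ℝ≥0)
    (hp : ∀ x, ∑ i, p x i ≤ 1) (c : ℝ≥0)
    (h : ∀ x y, f x ≠ f y → c ≤ ∑ i with x i ≠ y i, p x i) :
    CG f ≤ ((c ^ 2 / (4 * sensitivity f) : ℝ≥0) : ℝ≥0∞)⁻¹ := by
  classical
  -- The threshold for which `sensitivity f` discarded weights total at most `c / 2`. At zero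
  -- sensitivity it is `0`.
  set δ : ℝ≥0 := c / (2 * sensitivity f) with hδ
  let q : Input n → Fin n → ℝ≥0 := fun x i => if δ ≤ p x i then p x i else 0
  have hqp : ∀ x i, q x i ≤ p x i := fun x i => by
    simp only [q]; split_ifs <;> simp
  have hpq : ∀ x i, p x i ≤ q x i + δ := fun x i => by
    simp only [q]
    split_ifs with hle
    · exact le_self_add
    · rw [zero_add]; exact le_of_not_ge hle
  have hmul : ∀ x y i, δ * min (q x i) (q y i) ≤ q x i * q y i := fun x y i => by
    by_cases hx : δ ≤ p x i
    · exact mul_le_mul' (by simp [q, hx]) (min_le_right _ _)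
    · simp [q, hx]
  have hhalf : ∀ x y, f x ≠ f y → c / 2 ≤ ∑ i with x i ≠ y i, q x i := fun x y hxy => by
    obtain ⟨z, hz, hsub, hcard⟩ := exists_sensitive_hybrid f x y hxy
    have h1 : c ≤ ∑ i with x i ≠ z i, q x i + c / 2 := by
      calc c ≤ ∑ i with x i ≠ z i, p x i := h x z hz.symm
        _ ≤ ∑ i with x i ≠ z i, (q x i + δ) := Finset.sum_le_sum fun i _ => hpq x i
        _ = ∑ i with x i ≠ z i, q x i + (Finset.univ.filter fun i => x i ≠ z i).card * δ := by
          rw [Finset.sum_add_distrib, Finset.sum_const, nsmul_eq_mul]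
        _ ≤ ∑ i with x i ≠ z i, q x i + sensitivity f * δ := by gcongr
        _ ≤ _ := by
          gcongr
          rw [hδ]
          rcases eq_or_ne (sensitivity f : ℝ≥0) 0 with h0 | h0
          · simp [h0]
          · exact le_of_eq (by field_simp)
    have h2 : c / 2 ≤ ∑ i with x i ≠ z i, q x i := by
      have : c / 2 + c / 2 ≤ ∑ i with x i ≠ z i, q x i + c / 2 := by rwa [add_halves]
      exact le_of_add_le_add_right this
    refine h2.trans (Finset.sum_le_sum_of_subset fun i => ?_)
    simp only [Finset.mem_filter, Finset.mem_univ, true_and]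
    exact hsub i
  refine CG_le_of_subprob hn f q (fun x => (Finset.sum_le_sum fun i _ => hqp x i).trans (hp x)) _
    fun x y hx hy => ?_
  calc c ^ 2 / (4 * sensitivity f) = δ * (c / 2) := by rw [hδ, div_mul_div_comm]; ring
    _ ≤ δ * ∑ i with x i ≠ y i, min (q x i) (q y i) := by
      gcongr
      exact le_sum_min f q _ hhalf x y (by simp [hx, hy])
    _ ≤ _ := by
      rw [Finset.mul_sum]
      exact Finset.sum_le_sum fun i _ => hmul x y i

/-! ### Public coin games through their marginals. -/

open Classical in
/-- The distribution of the answer that a public coin strategy gives on `z`. -/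
noncomputable def publicMarginal {n : ℕ} {f : BoolFun n} (p : PublicStrategy f) (z : Input n)
    (i : Fin n) : ℝ≥0 :=
  ∑ S : DetStrategy f with
    (∃ h : f z = false, S.1 ⟨z, h⟩ = i) ∨ (∃ h : f z = true, S.2 ⟨z, h⟩ = i), p.1 S

theorem sum_publicMarginal {n : ℕ} {f : BoolFun n} (p : PublicStrategy f) (z : Input n) :
    ∑ i, publicMarginal p z i = 1 := by
  classical
  rw [← p.2]
  simp only [publicMarginal, Finset.sum_filter]
  rw [Finset.sum_comm]
  refine Finset.sum_congr rfl fun S _ => ?_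
  rcases Bool.eq_false_or_eq_true (f z) with hz | hz <;> simp [hz]

theorem publicWin_le_marginal {n : ℕ} {f : BoolFun n} (p : PublicStrategy f)
    (x : {x : Input n // f x = false}) (y : {y : Input n // f y = true}) :
    publicWin p x y ≤ ∑ i with x.1 i ≠ y.1 i, publicMarginal p x.1 i ∧
    publicWin p x y ≤ ∑ i with y.1 i ≠ x.1 i, publicMarginal p y.1 i := by
  classical
  obtain ⟨x, hx⟩ := x
  obtain ⟨y, hy⟩ := y
  constructor <;>
  · simp only [publicMarginal, publicWin, Finset.sum_filter]
    simp only [← Finset.sum_filter (fun i => _ ≠ _)]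
    rw [Finset.sum_comm]
    refine Finset.sum_le_sum fun S _ => ?_
    by_cases hS : DetStrategy.Correct S ⟨x, hx⟩ ⟨y, hy⟩
    · obtain ⟨h1, h2⟩ := hS
      rw [if_pos ⟨h1, h2⟩]
      refine le_trans ?_ (Finset.single_le_sum (fun i _ => zero_le)
        (Finset.mem_filter.2 ⟨Finset.mem_univ (S.1 ⟨x, hx⟩), ?_⟩))
      · simp [hx, hy, h1]
      · first | exact h2 | exact h2.symm
    · rw [if_neg hS]; exact zero_le

theorem CG_le_CGpub_sq_mul {n : ℕ} (hn : 0 < n) (f : BoolFun n) :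
    CG f ≤ 4 * (CGpub f ^ 2 * (sensitivity f : ℝ≥0∞)) := by
  by_cases hconst : ∀ x y, f x = false → f y = true → False
  · rw [CG_eq_zero_of_const hn f hconst]; exact bot_le
  push Not at hconst
  obtain ⟨a, b, ha, hb, -⟩ := hconst
  -- Needed because `⊤ * 0 = 0` would break the bound when the game value is infinite.
  have hs : sensitivity f ≠ 0 := fun h0 => by
    obtain ⟨z, hz, -, hcard⟩ := exists_sensitive_hybrid f a b (by simp [ha, hb])
    rw [h0, Nat.le_zero, Finset.card_eq_zero] at hcard
    refine hz (congrArg f (funext fun i => ?_))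
    by_contra hi
    have : i ∈ Finset.univ.filter fun i => a i ≠ z i := by simp [Ne.symm hi]
    simp [hcard] at this
  have main : ∀ p : PublicStrategy f, CG f ≤ 4 *
      ((⨆ (x : {x : Input n // f x = false}) (y : {y : Input n // f y = true}),
        (publicWin p x y : ℝ≥0∞)⁻¹) ^ 2 * (sensitivity f : ℝ≥0∞)) := fun p => by
    set M := ⨆ (x : {x : Input n // f x = false}) (y : {y : Input n // f y = true}),
        (publicWin p x y : ℝ≥0∞)⁻¹
    have hle : ∀ x y, (publicWin p x y : ℝ≥0∞)⁻¹ ≤ M := fun x y =>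
      le_iSup₂ (f := fun (x : {x : Input n // f x = false})
        (y : {y : Input n // f y = true}) => (publicWin p x y : ℝ≥0∞)⁻¹) x y
    have hM0 : M ≠ 0 := fun h0 => by
      have := hle ⟨a, ha⟩ ⟨b, hb⟩
      rw [h0] at this
      simp at this
    rcases eq_or_ne M ⊤ with hT | hT
    · rw [hT]; simp [hs]
    clear_value M
    lift M to ℝ≥0 using hT
    have hM0' : M ≠ 0 := by exact_mod_cast hM0
    have hwin : ∀ x y, M⁻¹ ≤ publicWin p x y := fun x y => by
      have h1 := ENNReal.inv_le_inv.2 (hle x y)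
      rw [inv_inv, ← ENNReal.coe_inv hM0'] at h1
      exact_mod_cast h1
    have := CG_le_of_fractional hn f (publicMarginal p) (fun x => (sum_publicMarginal p x).le) M⁻¹
      fun x y hxy => by
        cases hx : f x <;> cases hy : f y
        · simp [hx, hy] at hxy
        · exact (hwin ⟨x, hx⟩ ⟨y, hy⟩).trans (publicWin_le_marginal p _ _).1
        · exact (hwin ⟨y, hy⟩ ⟨x, hx⟩).trans (publicWin_le_marginal p _ _).2
        · simp [hx, hy] at hxy
    have hs' : (sensitivity f : ℝ≥0) ≠ 0 := by exact_mod_cast hs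
    rw [← ENNReal.coe_inv (by positivity)] at this
    refine this.trans (le_of_eq ?_)
    rw [show (M⁻¹ ^ 2 / (4 * (sensitivity f : ℝ≥0)))⁻¹ = 4 * (M ^ 2 * sensitivity f) by
      field_simp]
    push_cast
    rfl
  have h0 : (4 * sensitivity f : ℝ≥0∞) ≠ 0 := by simp [hs]
  have hT : (4 * sensitivity f : ℝ≥0∞) ≠ ⊤ := ENNReal.mul_ne_top (by simp) (by simp)
  have := le_iInf_sq fun p => (ENNReal.div_le_iff h0 hT).2 ((main p).trans_eq (by ring))
  exact ((ENNReal.div_le_iff h0 hT).1 this).trans_eq (by rw [CGpub]; ring)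

end CertGame

namespace CertGame

/-! ### From certificate games to zero-error decision trees -/

/-- If two finite sets of vectors have all mutual inner products at least `c`, then a point of one
of the two convex hulls has inner product at least `c` with all the vectors of both. -/
theorem exists_inner_ge_of_inner_ge {E : Type*} [NormedAddCommGroup E] [InnerProductSpace ℝ E]
    {s t : Set E} (hs : s.Finite) (ht : t.Finite) (hs' : s.Nonempty) (ht' : t.Nonempty) (c : ℝ)
    (h : ∀ u ∈ s, ∀ v ∈ t, c ≤ inner ℝ u v) :
    ∃ r, (r ∈ convexHull ℝ s ∨ r ∈ convexHull ℝ t) ∧ ∀ w ∈ s ∪ t, c ≤ inner ℝ r w := by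
  have hconv : ∀ u : E, Convex ℝ {v | c ≤ inner ℝ u v} := fun u =>
    convex_halfSpace_ge (innerSL ℝ u).toLinearMap.isLinear c
  have hst : ∀ u ∈ s, ∀ v ∈ convexHull ℝ t, c ≤ inner ℝ u v := fun u hu v hv =>
    convexHull_min (fun v hv => h u hu v hv) (hconv u) hv
  have hts : ∀ v ∈ convexHull ℝ t, ∀ u ∈ convexHull ℝ s, c ≤ inner ℝ v u := fun v hv u hu =>
    convexHull_min (fun u hu => by
      rw [Set.mem_ofPred_eq, real_inner_comm]; exact hst u hu v hv) (hconv v) hu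
  have hmin : ∀ k : Set E, k.Finite → k.Nonempty →
      ∃ r ∈ convexHull ℝ k, ∀ w ∈ convexHull ℝ k, ‖r‖ ^ 2 ≤ inner ℝ r w := fun k hk hk' => by
    have hc := convex_convexHull ℝ k
    obtain ⟨r, hr, hr'⟩ := exists_norm_eq_iInf_of_complete_convex (hk'.convexHull (𝕜 := ℝ))
      (hk.isCompact_convexHull ℝ).isComplete hc 0
    refine ⟨r, hr, fun w hw => ?_⟩
    have := (norm_eq_iInf_iff_real_inner_le_zero hc hr).1 hr' w hw
    rw [zero_sub, inner_neg_left, inner_sub_right, real_inner_self_eq_norm_sq] at this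
    linarith
  obtain ⟨u, hu, hu'⟩ := hmin s hs hs'
  obtain ⟨v, hv, hv'⟩ := hmin t ht ht'
  -- One of the two minimum-norm points has squared norm at least `c`, since `c ≤ ⟪v, u⟫ ≤ ‖v‖ ‖u‖`.
  rcases le_or_gt c (‖u‖ ^ 2) with hcu | hcu
  · refine ⟨u, Or.inl hu, fun w hw => ?_⟩
    rcases hw with hw | hw
    · exact hcu.trans (hu' w (subset_convexHull ℝ s hw))
    · rw [real_inner_comm]
      exact hts w (subset_convexHull ℝ t hw) u hu
  · refine ⟨v, Or.inr hv, fun w hw => ?_⟩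
    rcases hw with hw | hw
    · exact hts v hv w (subset_convexHull ℝ s hw)
    · refine le_trans ?_ (hv' w (subset_convexHull ℝ t hw))
      by_contra! hcv
      have h1 := hts v hv u hu
      have h2 := real_inner_le_norm v u
      nlinarith [sq_nonneg (‖u‖ - ‖v‖)]

/-- There is a query distribution on the unqueried positions that makes expected progress at
least `c` for all the inputs that agree with `a` on `S`. -/
theorem exists_query_dist {n : ℕ} (f : BoolFun n) (p : Input n → Fin n → ℝ≥0)
    (hp : ∀ x, ∑ i, p x i ≤ 1) (c : ℝ≥0) (hc : 0 < c)
    (h : ∀ x y, f x = false → f y = true → c ≤ ∑ i with x i ≠ y i, p x i * p y i)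
    (S : Finset (Fin n)) (a : Input n)
    (h0 : ∃ x, (∀ i ∈ S, x i = a i) ∧ f x = false) (h1 : ∃ y, (∀ i ∈ S, y i = a i) ∧ f y = true) :
    ∃ ρ : Fin n → ℝ≥0, ∑ i, ρ i = 1 ∧ (∀ i ∈ S, ρ i = 0) ∧
      ∀ z, (∀ i ∈ S, z i = a i) → c ≤ ∑ i, ρ i * p z i := by
  classical
  -- Inputs agreeing with `a` on `S` differ only outside `S`, so zeroing these coordinates keeps the
  -- lower bound `c`.
  let v : Input n → EuclideanSpace ℝ (Fin n) := fun z =>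
    WithLp.toLp 2 fun i => if i ∈ S then 0 else (p z i : ℝ)
  let Z : Bool → Set (Input n) := fun b => {z | (∀ i ∈ S, z i = a i) ∧ f z = b}
  have hinner : ∀ (r : EuclideanSpace ℝ (Fin n)) z, (∀ i ∈ S, r i = 0) →
      inner ℝ r (v z) = ∑ i, r i * p z i := fun r z hr => by
    rw [PiLp.inner_apply]
    refine Finset.sum_congr rfl fun i _ => ?_
    by_cases hi : i ∈ S
    · simp [hr i hi]
    · simp [v, hi, mul_comm]
  have hv0 : ∀ z, ∀ i ∈ S, v z i = 0 := fun z i hi => by simp [v, hi]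
  have hpair : ∀ x ∈ Z false, ∀ y ∈ Z true, (c : ℝ) ≤ inner ℝ (v x) (v y) := by
    rintro x ⟨hx, hfx⟩ y ⟨hy, hfy⟩
    rw [hinner _ _ (hv0 x)]
    have : (c : ℝ) ≤ ∑ i with x i ≠ y i, (p x i : ℝ) * p y i := by
      exact_mod_cast h x y hfx hfy
    refine this.trans ?_
    calc ∑ i with x i ≠ y i, (p x i : ℝ) * p y i = ∑ i with x i ≠ y i, v x i * p y i := by
          refine Finset.sum_congr rfl fun i hi => ?_
          have : i ∉ S := fun hS => (Finset.mem_filter.1 hi).2 ((hx i hS).trans (hy i hS).symm)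
          simp [v, this]
      _ ≤ _ := Finset.sum_le_sum_of_subset_of_nonneg (Finset.filter_subset _ _) fun i _ _ => by
          refine mul_nonneg ?_ (NNReal.coe_nonneg _)
          simp only [v]
          split_ifs <;> simp
  obtain ⟨r, hr, hr'⟩ := exists_inner_ge_of_inner_ge ((Set.toFinite (Z false)).image v)
    ((Set.toFinite (Z true)).image v) (Set.Nonempty.image v h0) (Set.Nonempty.image v h1) c
    (by rintro _ ⟨x, hx, rfl⟩ _ ⟨y, hy, rfl⟩; exact hpair x hx y hy)
  let K : Set (EuclideanSpace ℝ (Fin n)) :=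
    {r | (∀ i, 0 ≤ r i) ∧ (∀ i ∈ S, r i = 0) ∧ ∑ i, r i ≤ 1}
  have hK : Convex ℝ K := by
    rintro x ⟨hx1, hx2, hx3⟩ y ⟨hy1, hy2, hy3⟩ α β hα hβ hαβ
    refine ⟨fun i => ?_, fun i hi => ?_, ?_⟩
    · have := mul_nonneg hα (hx1 i)
      have := mul_nonneg hβ (hy1 i)
      simp only [PiLp.add_apply, PiLp.smul_apply, smul_eq_mul]
      linarith
    · simp [hx2 i hi, hy2 i hi]
    · simp only [PiLp.add_apply, PiLp.smul_apply, smul_eq_mul, Finset.sum_add_distrib,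
        ← Finset.mul_sum]
      nlinarith
  have hvK : ∀ z, v z ∈ K := fun z => by
    refine ⟨fun i => ?_, hv0 z, ?_⟩
    · simp only [v]; split_ifs <;> simp
    · have h2 : ∑ i, (p z i : ℝ) ≤ 1 := by exact_mod_cast hp z
      refine le_trans (Finset.sum_le_sum fun i _ => ?_) h2
      simp only [v]; split_ifs <;> simp
  have hrK : r ∈ K := by
    rcases hr with hr | hr <;>
    · refine convexHull_min ?_ hK hr
      rintro _ ⟨z, -, rfl⟩
      exact hvK z
  obtain ⟨hr1, hr2, hr3⟩ := hrK
  have hprog : ∀ z, (∀ i ∈ S, z i = a i) → (c : ℝ) ≤ ∑ i, r i * p z i := fun z hz => by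
    rw [← hinner r z hr2]
    refine hr' _ ?_
    cases hfz : f z
    · exact Or.inl ⟨z, ⟨hz, hfz⟩, rfl⟩
    · exact Or.inr ⟨z, ⟨hz, hfz⟩, rfl⟩
  let q : Fin n → ℝ≥0 := fun i => (r i).toNNReal
  have hq : ∀ i, (q i : ℝ) = r i := fun i => Real.coe_toNNReal _ (hr1 i)
  have hq1 : ∑ i, q i ≤ 1 := by
    rw [← NNReal.coe_le_coe]; push_cast; simpa only [hq] using hr3
  have hqprog : ∀ z, (∀ i ∈ S, z i = a i) → c ≤ ∑ i, q i * p z i := fun z hz => by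
    rw [← NNReal.coe_le_coe]; push_cast; simpa only [hq] using hprog z hz
  have hq0 : ∑ i, q i ≠ 0 := fun h0' => by
    obtain ⟨x, hx, -⟩ := h0
    have h2 := hqprog x hx
    have h3 : ∀ i, q i = 0 := fun i => Finset.sum_eq_zero_iff.1 h0' i (Finset.mem_univ i)
    simp [h3, hc.ne'] at h2
  -- Normalising divides by a sum at most 1, so progress does not decrease.
  refine ⟨fun i => q i / ∑ j, q j, ?_, fun i hi => by simp [q, hr2 i hi], fun z hz => ?_⟩
  · rw [← Finset.sum_div, div_self hq0]
  · refine (hqprog z hz).trans (Finset.sum_le_sum fun i _ => ?_)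
    gcongr
    exact le_div_self zero_le (pos_iff_ne_zero.2 hq0) hq1

/-! ### Random decision trees and their expected cost. -/

/-- The expectation of an extended nonnegative function. -/
noncomputable def expect {α : Type*} (μ : PMF α) (F : α → ℝ≥0∞) : ℝ≥0∞ := ∑' a, μ a * F a

theorem expect_bind {α β : Type*} (μ : PMF α) (g : α → PMF β) (F : β → ℝ≥0∞) :
    expect (μ.bind g) F = expect μ fun a => expect (g a) F := by
  simp only [expect, PMF.bind_apply, ← ENNReal.tsum_mul_right, ← ENNReal.tsum_mul_left]
  rw [ENNReal.tsum_comm]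
  simp only [mul_assoc]

theorem expect_pure {α : Type*} (a : α) (F : α → ℝ≥0∞) : expect (PMF.pure a) F = F a := by
  classical
  rw [expect, tsum_eq_single a fun b hb => by simp [PMF.pure_apply, hb]]
  simp

theorem expect_const {α : Type*} (μ : PMF α) (c : ℝ≥0∞) : expect μ (fun _ => c) = c := by
  rw [expect, ENNReal.tsum_mul_right, μ.tsum_coe, one_mul]

theorem expect_const_add {α : Type*} (μ : PMF α) (c : ℝ≥0∞) (F : α → ℝ≥0∞) :
    expect μ (fun a => c + F a) = c + expect μ F := by
  conv_rhs => rw [← expect_const μ c]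
  simp only [expect, mul_add, ENNReal.tsum_add]

/-- Sample an index from `R`, and the two subtrees from the distributions that belong to it. -/
noncomputable def queryDist {n : ℕ} (R : PMF (Fin n)) (μ : Fin n → Bool → PMF (DecisionTree n)) :
    PMF (DecisionTree n) :=
  R.bind fun i => (μ i false).bind fun t₀ => (μ i true).bind fun t₁ => PMF.pure (.query i t₀ t₁)

theorem expect_cost_queryDist {n : ℕ} (R : PMF (Fin n))
    (μ : Fin n → Bool → PMF (DecisionTree n)) (z : Input n) :
    expect (queryDist R μ) (fun T => (T.cost z : ℝ≥0∞)) =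
      expect R fun i => 1 + expect (μ i (z i)) fun T => (T.cost z : ℝ≥0∞) := by
  simp only [queryDist, expect_bind, expect_pure, DecisionTree.cost]
  congr 1
  funext i
  cases z i <;> simp [expect_const, expect_const_add]

/-- A potential argument: the unqueried mass of `p z` pays `c` per query in expectation. Induction
is on the number of unqueried positions. -/
theorem exists_treeDist {n : ℕ} (f : BoolFun n) (p : Input n → Fin n → ℝ≥0)
    (hp : ∀ x, ∑ i, p x i ≤ 1) (c : ℝ≥0) (hc : 0 < c)
    (h : ∀ x y, f x = false → f y = true → c ≤ ∑ i with x i ≠ y i, p x i * p y i)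
    (S : Finset (Fin n)) (a : Input n) :
    ∃ μ : PMF (DecisionTree n),
      (∀ T ∈ μ.support, ∀ z, (∀ i ∈ S, z i = a i) → T.eval z = f z) ∧
      ∀ z, (∀ i ∈ S, z i = a i) →
        c * expect μ (fun T => (T.cost z : ℝ≥0∞)) ≤ ∑ i ∈ Sᶜ, (p z i : ℝ≥0∞) := by
  classical
  induction hk : Sᶜ.card using Nat.strong_induction_on generalizing S a with
  | _ k ih =>
  by_cases hconst : ∃ b, ∀ z, (∀ i ∈ S, z i = a i) → f z = b
  · obtain ⟨b, hb⟩ := hconst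
    refine ⟨PMF.pure (.leaf b), fun T hT z hz => ?_, fun z hz => ?_⟩
    · rw [PMF.support_pure, Set.mem_singleton_iff] at hT
      rw [hT, hb z hz, DecisionTree.eval]
    · simp [expect_pure, DecisionTree.cost]
  push Not at hconst
  obtain ⟨ρ, hρ1, hρS, hρ⟩ := exists_query_dist f p hp c hc h S a
    (by simpa using hconst true) (by simpa using hconst false)
  have hR1 : ∑ i, (ρ i : ℝ≥0∞) = 1 := by exact_mod_cast hρ1
  let R : PMF (Fin n) := PMF.ofFintype (fun i => (ρ i : ℝ≥0∞)) hR1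
  have hsub : ∀ (i : Fin n) (b : Bool), ∃ μ : PMF (DecisionTree n), i ∉ S →
      (∀ T ∈ μ.support, ∀ z, (∀ j ∈ insert i S, z j = Function.update a i b j) →
        T.eval z = f z) ∧
      ∀ z, (∀ j ∈ insert i S, z j = Function.update a i b j) →
        c * expect μ (fun T => (T.cost z : ℝ≥0∞)) ≤ ∑ j ∈ (insert i S)ᶜ, (p z j : ℝ≥0∞) := by
    intro i b
    by_cases hi : i ∈ S
    -- A dummy tree: queried positions have `ρ i = 0` and are never sampled.
    · exact ⟨PMF.pure (.leaf b), fun h => (h hi).elim⟩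
    · obtain ⟨μ, hμ⟩ := ih (insert i S)ᶜ.card (by
        rw [← hk]
        exact Finset.card_lt_card (Finset.compl_ssubset_compl.2 (Finset.ssubset_insert hi)))
        (insert i S) (Function.update a i b) rfl
      exact ⟨μ, fun _ => hμ⟩
  choose μ hμ using hsub
  have hagree : ∀ z : Input n, (∀ i ∈ S, z i = a i) → ∀ i ∉ S,
      ∀ j ∈ insert i S, z j = Function.update a i (z i) j := fun z hz i hi j hj => by
    rcases eq_or_ne j i with rfl | hji
    · simp
    · rw [Function.update_of_ne hji]
      exact hz j (Finset.mem_of_mem_insert_of_ne hj hji)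
  refine ⟨queryDist R μ, fun T hT z hz => ?_, fun z hz => ?_⟩
  · simp only [queryDist, PMF.mem_support_bind_iff, PMF.support_pure,
      Set.mem_singleton_iff] at hT
    obtain ⟨i, hi, t₀, ht₀, t₁, ht₁, rfl⟩ := hT
    have hiS : i ∉ S := fun hS => hi (by simp [R, hρS i hS])
    have hz' := hagree z hz i hiS
    rw [DecisionTree.eval]
    cases hzi : z i <;> rw [hzi] at hz'
    · exact (hμ i false hiS).1 _ ht₀ z hz'
    · exact (hμ i true hiS).1 _ ht₁ z hz'
  · rw [expect_cost_queryDist, expect, tsum_fintype, Finset.mul_sum]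
    -- The consumed mass is added on the left to avoid truncated subtraction; after summation it
    -- pays for `c` and cancels.
    have hstep : ∀ i, (c : ℝ≥0∞) * (R i * (1 + expect (μ i (z i)) fun T => (T.cost z : ℝ≥0∞))) +
        ρ i * p z i ≤ ρ i * c + ρ i * ∑ j ∈ Sᶜ, (p z j : ℝ≥0∞) := fun i => by
      by_cases hi : i ∈ S
      · simp [R, hρS i hi]
      have hins : ∑ j ∈ Sᶜ, (p z j : ℝ≥0∞) = p z i + ∑ j ∈ (insert i S)ᶜ, (p z j : ℝ≥0∞) := by
        rw [Finset.compl_insert]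
        exact (Finset.add_sum_erase _ (fun j => (p z j : ℝ≥0∞)) (Finset.mem_compl.2 hi)).symm
      have hi' := (hμ i (z i) hi).2 z (hagree z hz i hi)
      calc (c : ℝ≥0∞) * (R i * (1 + expect (μ i (z i)) fun T => (T.cost z : ℝ≥0∞))) + ρ i * p z i
          = ρ i * c + ρ i * (p z i + c * expect (μ i (z i)) fun T => (T.cost z : ℝ≥0∞)) := by
            simp only [R, PMF.ofFintype_apply]; ring
        _ ≤ _ := by rw [hins]; gcongr
    have hsum := Finset.sum_le_sum fun i (_ : i ∈ Finset.univ) => hstep i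
    rw [Finset.sum_add_distrib, Finset.sum_add_distrib, ← Finset.sum_mul, ← Finset.sum_mul, hR1,
      one_mul, one_mul, add_comm (c : ℝ≥0∞)] at hsum
    have hcz : (c : ℝ≥0∞) ≤ ∑ i, (ρ i * p z i : ℝ≥0∞) := by exact_mod_cast hρ z hz
    have hfin : ∑ i, (ρ i * p z i : ℝ≥0∞) ≠ ⊤ := by
      simp [ENNReal.sum_eq_top, ENNReal.mul_eq_top]
    exact (ENNReal.add_le_add_iff_right hfin).1 (hsum.trans (by gcongr))

theorem R0_le_CG {n : ℕ} (f : BoolFun n) : R0 f ≤ CG f := by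
  refine le_iInf fun p => ?_
  set M := ⨆ (x : {x : Input n // f x = false}) (y : {y : Input n // f y = true}),
    (privateWin p x.1 y.1 : ℝ≥0∞)⁻¹
  have hle : ∀ x y, f x = false → f y = true → (privateWin p x y : ℝ≥0∞)⁻¹ ≤ M :=
    fun x y hx hy => le_iSup₂ (f := fun (x : {x : Input n // f x = false})
      (y : {y : Input n // f y = true}) => (privateWin p x.1 y.1 : ℝ≥0∞)⁻¹) ⟨x, hx⟩ ⟨y, hy⟩
  by_cases hconst : ∃ b, ∀ z, f z = b
  · obtain ⟨b, hb⟩ := hconst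
    have hzero : ZeroError f (PMF.pure (.leaf b)) := fun T hT z => by
      rw [PMF.support_pure, Set.mem_singleton_iff] at hT
      rw [hT, hb z, DecisionTree.eval]
    refine (iInf_le _ ⟨_, hzero⟩).trans (iSup_le fun z => ?_)
    exact (expect_pure (.leaf b) fun T => (DecisionTree.cost T z : ℝ≥0∞)).trans_le
      (by simp [DecisionTree.cost])
  push Not at hconst
  obtain ⟨x₀, hx₀⟩ := hconst true
  obtain ⟨y₀, hy₀⟩ := hconst false
  have hM0 : M ≠ 0 := fun h0 => by
    have := hle x₀ y₀ (by simpa using hx₀) (by simpa using hy₀)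
    rw [h0] at this
    simp at this
  rcases eq_or_ne M ⊤ with hT | hT
  · rw [hT]; exact le_top
  clear_value M
  lift M to ℝ≥0 using hT
  have hM0' : M ≠ 0 := by exact_mod_cast hM0
  obtain ⟨μ, hμ, hμ'⟩ := exists_treeDist f p.1 (fun x => (p.2 x).le) M⁻¹
    (inv_pos.2 (pos_iff_ne_zero.2 hM0')) (fun x y hx hy => by
      have h1 := ENNReal.inv_le_inv.2 (hle x y hx hy)
      rw [inv_inv, ← ENNReal.coe_inv hM0'] at h1
      exact_mod_cast h1) ∅ x₀
  refine (iInf_le _ ⟨μ, fun T hT z => hμ T hT z (by simp)⟩).trans (iSup_le fun z => ?_)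
  have h1 := hμ' z (by simp)
  have h2 : ∑ i, (p.1 z i : ℝ≥0∞) = 1 := by exact_mod_cast p.2 z
  rw [Finset.compl_empty, h2, ENNReal.coe_inv hM0', mul_comm, ← div_eq_mul_inv,
    ENNReal.div_le_iff hM0 ENNReal.coe_ne_top, one_mul] at h1
  exact h1

end CertGame

theorem mainTheorem6 :
    (∀ (n : ℕ) (_ : 0 < n) (f : CertGame.BoolFun n),
      CertGame.MM f ^ 2 ≤ CertGame.CG f) ∧
    ((∀ (n : ℕ) (_ : 0 < n) (f : CertGame.BoolFun n),
        CertGame.R0 f ≤ CertGame.CG f) ∧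
      ∃ K : ℝ≥0, ∀ (n : ℕ) (_ : 0 < n) (f : CertGame.BoolFun n),
        CertGame.CG f ≤ (K : ℝ≥0∞) * CertGame.EC f ^ 2) ∧
    (∃ K : ℝ≥0, ∀ (n : ℕ) (_ : 0 < n) (f : CertGame.BoolFun n),
      CertGame.CG f ≤
        (K : ℝ≥0∞) * (CertGame.CGpub f ^ 2 * (CertGame.sensitivity f : ℝ≥0∞))) ∧
    (∀ (n : ℕ) (_ : 0 < n) (f : CertGame.BoolFun n),
      CertGame.CG f ≤
        (CertGame.certComplexity false f : ℝ≥0∞) * (CertGame.certComplexity true f : ℝ≥0∞)) :=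
  ⟨fun _ _ f => CertGame.MM_sq_le_CG f,
    ⟨fun _ _ f => CertGame.R0_le_CG f,
      1, fun _ hn f => by simpa using CertGame.CG_le_EC_sq hn f⟩,
    ⟨4, fun _ hn f => by simpa using CertGame.CG_le_CGpub_sq_mul hn f⟩,
    fun _ hn f => CertGame.CG_le_certComplexity_mul hn f⟩
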